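/- Fix $\delta>0$ and let $X=(X(t))_{t\ge 0}$ be a real-valued (time-homogeneous) strong Markov process with continuous paths, relative to some filtration $(\mathcal F_t)$ to which it is adapted; that is, there is a Markov transition semigroup $(\kappa_t)_{t\ge0}$ on $\mathbb R$ such that for every stopping time $\tau$, every $t\ge0$ and every Borel set $A$, almost surely on $\{\tau<\infty\}$, $\mathbb P(X(\tau+t)\in A\mid\mathcal F_\tau)=\kappa_t(X(\tau),A)$. Suppose $X(0)=0$ almost surely. Define the size-$\delta$ (level-0) crossing times by $T_0=0$ and $T_{j+1}=\inf\{t>T_j : |X(t)-X(T_j)|=\delta\}$ (with $\inf\emptyset=\infty$), and assume that almost surely $T_j<\infty$ for all $j$. Let $\alpha_k=\operatorname{sgn}(X(T_{k+1})-X(T_k))$, $k=0,1,2,\dots$, be the crossing orientations. Group the crossings into consecutive pairs with orientations $(\alpha_{2i},\alpha_{2i+1})$, $i=0,1,2,\dots$. A pair with orientations $+-$ is called an excursion up and a pair with orientations $-+$ an excursion down. Let $V_j=0$ if the $j$-th excursion is up and $V_j=1$ if it is down. Suppose that the probability that a size-$\delta$ crossing starting at $x$ goes up, $$p_\delta(x)=\mathbb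 P\big(X(T_{k+1})=x+\delta \,\big|\, X(T_k)=x\big),$$ is equal to one and the same constant $p\notin\{0,1\}$ for all $x\in\delta\mathbb Z$ and $k\ge0$ with $\mathbb P(X(T_k)=x)>0$. Then almost surely there are infinitely many excursions, and $(V_j)_j$ is an i.i.d. sequence with $\mathbb P(V_j=0)=\mathbb P(V_j=1)=1/2$. -/

import Mathlib

open MeasureTheory ProbabilityTheory
open scoped NNReal ENNReal

noncomputable section

namespace CrossingTree

variable {Ω : Type*}

/-- A (time-homogeneous, conservative) Markov transition semigroup on `ℝ`. -/
structure IsTransitionSemigroup (κ : ℝ≥0 → Kernel ℝ ℝ) : Prop where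
  isMarkov : ∀ t, IsMarkovKernel (κ t)
  zero : κ 0 = Kernel.id
  add : ∀ s t, κ (s + t) = κ t ∘ₖ κ s

/-- `X` is a real-valued continuous strong Markov process with respect to the filtration `𝓕`:
its paths are continuous, it is adapted, and for some transition semigroup `κ`, every stopping
time `τ` (possibly infinite), every `t ≥ 0` and every Borel set `A`,
`P(τ < ∞, X(τ + t) ∈ A | 𝓕_τ) = 1_{τ < ∞} κ_t(X(τ), A)` almost surely. -/
structure IsContinuousStrongMarkov {mΩ : MeasurableSpace Ω} (μ : Measure Ω)
    (𝓕 : Filtration ℝ≥0 mΩ) (X : ℝ≥0 → Ω → ℝ) : Prop where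
  continuous_paths : ∀ ω, Continuous fun t => X t ω
  adapted : Adapted 𝓕 X
  strong_markov : ∃ κ : ℝ≥0 → Kernel ℝ ℝ, IsTransitionSemigroup κ ∧
    ∀ (τ : Ω → WithTop ℝ≥0) (hτ : IsStoppingTime 𝓕 τ) (t : ℝ≥0) (A : Set ℝ), MeasurableSet A →
      μ[{ω | τ ω ≠ ⊤ ∧ stoppedValue X (fun ω => τ ω + (t : WithTop ℝ≥0)) ω ∈ A}.indicator
          (fun _ => (1 : ℝ)) | hτ.measurableSpace]
        =ᵐ[μ] {ω | τ ω ≠ ⊤}.indicator fun ω => (κ t (stoppedValue X τ ω)).real A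

/-- The crossing times `T^l_j`: `T^l_0 = 0` and
`T^l_{j+1} = inf {t > T^l_j : |X(t) - X(T^l_j)| = 2^l δ}`, with `inf ∅ = ∞`
(and `T^l_{j+1} = ∞` when `T^l_j = ∞`). -/
def crossingTime (X : ℝ≥0 → Ω → ℝ) (δ : ℝ) (l : ℤ) : ℕ → Ω → WithTop ℝ≥0
  | 0, _ => ((0 : ℝ≥0) : WithTop ℝ≥0)
  | j + 1, ω =>
    sInf {t : WithTop ℝ≥0 | ∃ s u : ℝ≥0, crossingTime X δ l j ω = (s : WithTop ℝ≥0) ∧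
      t = (u : WithTop ℝ≥0) ∧ s < u ∧ |X u ω - X s ω| = (2 : ℝ) ^ l * δ}

/-- The crossing points `X(T^l_j)` (of interest only where `T^l_j < ∞`). -/
def crossingPoint (X : ℝ≥0 → Ω → ℝ) (δ : ℝ) (l : ℤ) (j : ℕ) : Ω → ℝ :=
  stoppedValue X (crossingTime X δ l j)

/-- The orientations `α^l_k = sgn (X(T^l_{k+1}) - X(T^l_k))`, `k = 0, 1, …`. -/
def orientation (X : ℝ≥0 → Ω → ℝ) (δ : ℝ) (l : ℤ) (k : ℕ) (ω : Ω) : SignType :=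
  SignType.sign (crossingPoint X δ l (k + 1) ω - crossingPoint X δ l k ω)

/-- The `i`-th pair of level `l` crossings, `(2i, 2i+1)`, is an excursion up (`+-`).
The subcrossings come in consecutive pairs: a level `l + 1` crossing consists of a number of
pairs of level `l` crossings with opposite orientations (the excursions), followed by one pair with
equal orientations (the direct crossing). Hence each level `l + 1` crossing contains an even number
of level `l` crossings and starts at an even index, so the pairs are the `(2i, 2i+1)`. -/
def IsUpExcursion (X : ℝ≥0 → Ω → ℝ) (δ : ℝ) (l : ℤ) (ω : Ω) (i : ℕ) : Prop :=
  orientation X δ l (2 * i) ω = 1 ∧ orientation X δ l (2 * i + 1) ω = -1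

/-- The `i`-th pair of level `l` crossings is an excursion down (`-+`). -/
def IsDownExcursion (X : ℝ≥0 → Ω → ℝ) (δ : ℝ) (l : ℤ) (ω : Ω) (i : ℕ) : Prop :=
  orientation X δ l (2 * i) ω = -1 ∧ orientation X δ l (2 * i + 1) ω = 1

/-- The `i`-th pair of level `l` crossings is an excursion (up or down). -/
def IsExcursion (X : ℝ≥0 → Ω → ℝ) (δ : ℝ) (l : ℤ) (ω : Ω) (i : ℕ) : Prop :=
  IsUpExcursion X δ l ω i ∨ IsDownExcursion X δ l ω i

open Classical in
/-- The type `V^l_j` of the `j`-th level `l` excursion (counted from `j = 0`): `0` if it is up, `1`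
if it is down. Only meaningful where there are more than `j` excursions. -/
def excursionType (X : ℝ≥0 → Ω → ℝ) (δ : ℝ) (l : ℤ) (j : ℕ) (ω : Ω) : ℕ :=
  if IsUpExcursion X δ l ω (Nat.nth (IsExcursion X δ l ω) j) then 0 else 1

/-- `P(X(T^0_{k+1}) = x + δ | X(T^0_k) = x)`: the probability that a size `δ` crossing (the one
with index `k`) that starts at `x` goes up. Only meaningful if `P(X(T^0_k) = x) > 0`. -/
def upProb {mΩ : MeasurableSpace Ω} (μ : Measure Ω) (X : ℝ≥0 → Ω → ℝ) (δ : ℝ) (k : ℕ) (x : ℝ) :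
    ℝ≥0∞ :=
  ProbabilityTheory.cond μ {ω | crossingPoint X δ 0 k ω = x}
    {ω | crossingPoint X δ 0 (k + 1) ω = x + δ}

end CrossingTree

end

/-!
The two kinds of excursion are equally likely given the past, because `p (1 - p) = (1 - p) p`.

* A crossing time is the hitting time of a closed set by a continuous path, hence a stopping time
  (`isStoppingTime_crossingTime`). Iterating the strong Markov property over finitely many times and
  applying a `π`-`λ` argument on path space shows that the path after a stopping time `τ` is
  independent of the past given the value of `X τ`
  (`IsContinuousStrongMarkov.measure_inter_futurePath_mul`).
* The direction of a crossing is a function of the path after its start, and crossings start in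
  `δℤ`, where the probability of going up is always `p`. So, given the past, each crossing goes up
  with probability `p`, whatever has happened before (`measure_inter_orientation_one`).
* Hence, given the past of the `i`-th pair of crossings, the pair is an excursion up with
  probability `p (1 - p)` and an excursion down with the same positive probability. Infinitely many
  excursions follow (`ae_infinite_marks`). Decomposing according to the index of the pair that forms
  the `n`-th excursion, the up and down cases have equal probability on each event determined by the
  first `n` types (`measure_inter_downAt`), so the type of the `n`-th excursion is a fair coin
  independent of the previous ones (`iIndepSet_downAt`).
-/

namespace CrossingTree

/-! ### Types of the successive marks of a sequence of events -/

section Marks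

variable {Ω : Type*} {mΩ : MeasurableSpace Ω}

open Classical in
/-- The event that exactly `n` of the events `U 0 ∪ D 0, …, U (i - 1) ∪ D (i - 1)` occur. -/
def countEq (U D : ℕ → Set Ω) (i n : ℕ) : Set Ω :=
  {ω | Nat.count (fun k => ω ∈ U k ∪ D k) i = n}

/-- Call an occurrence of `U i ∪ D i` a mark at time `i`, of type `U` or `D`. This is the event that
the `n`-th mark (counted from `0`) exists and is of type `D`. -/
def downAt (U D : ℕ → Set Ω) (n : ℕ) : Set Ω :=
  ⋃ i, countEq U D i n ∩ D i

variable {U D : ℕ → Set Ω}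

lemma countEq_swap (U D : ℕ → Set Ω) (i n : ℕ) : countEq U D i n = countEq D U i n := by
  classical
  ext ω
  simp only [countEq, Set.mem_ofPred_eq, Set.union_comm]

lemma pairwise_disjoint_countEq_inter (n : ℕ) {s : ℕ → Set Ω} (hs : ∀ i, s i ⊆ U i ∪ D i) :
    Pairwise (Function.onFun Disjoint fun i => countEq U D i n ∩ s i) := by
  classical
  intro i j hij
  refine Set.disjoint_left.2 fun ω hi hj => hij ?_
  exact Nat.count_injective (p := fun k => ω ∈ U k ∪ D k) (hs i hi.2) (hs j hj.2)
    (hi.1.trans hj.1.symm)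

/-- If infinitely many of the events `U i ∪ D i` occur, the `n`-th one exists, and its index is the
only index that contributes to `downAt U D n`. -/
lemma mem_downAt_iff {ω : Ω}
    (hω : {i | ω ∈ U i ∪ D i}.Infinite) (n : ℕ) :
    ω ∈ downAt U D n ↔ ω ∈ D (Nat.nth (fun i => ω ∈ U i ∪ D i) n) := by
  classical
  have hc := Nat.count_nth_of_infinite (p := fun i => ω ∈ U i ∪ D i) hω n
  constructor
  · intro h
    obtain ⟨i, hi, hD⟩ := Set.mem_iUnion.1 h
    have : i = Nat.nth (fun i => ω ∈ U i ∪ D i) n :=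
      Nat.count_injective (p := fun k => ω ∈ U k ∪ D k) (Or.inr hD)
        (Nat.nth_mem_of_infinite hω n) (by rw [hc]; exact hi)
    rwa [← this]
  · intro h
    refine Set.mem_iUnion.2 ⟨_, ?_, h⟩
    exact hc

variable {G : Filtration ℕ mΩ}

lemma measurableSet_countEq (hU : ∀ i, MeasurableSet[G (i + 1)] (U i))
    (hD : ∀ i, MeasurableSet[G (i + 1)] (D i)) (i n : ℕ) :
    MeasurableSet[G i] (countEq U D i n) := by
  classical
  induction i generalizing n with
  | zero =>
    simp only [countEq, Nat.count_zero]
    exact MeasurableSet.const _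
  | succ i ih =>
    have hE : MeasurableSet[G (i + 1)] (U i ∪ D i) := (hU i).union (hD i)
    have key : countEq U D (i + 1) n =
        (countEq U D i n ∩ (U i ∪ D i)ᶜ) ∪ ((⋃ m ∈ {m | m + 1 = n}, countEq U D i m) ∩
          (U i ∪ D i)) := by
      ext ω
      rw [Set.mem_union, Set.mem_inter_iff, Set.mem_inter_iff]
      by_cases h : ω ∈ U i ∪ D i <;>
        simp [countEq, Nat.count_succ, h, -Set.mem_union, -Set.compl_union]
    rw [key]
    exact ((G.mono i.le_succ _ (ih n)).inter hE.compl).union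
      ((MeasurableSet.biUnion (Set.to_countable _) fun m _ => G.mono i.le_succ _ (ih m)).inter hE)

/-- The type of one of the first `n` marks is, on the event that `n` marks occur before time
`i`, determined at time `i`. -/
lemma measurableSet_downAt_inter_countEq (hU : ∀ i, MeasurableSet[G (i + 1)] (U i))
    (hD : ∀ i, MeasurableSet[G (i + 1)] (D i)) {j n : ℕ} (hjn : j < n) (i : ℕ) :
    MeasurableSet[G i] (downAt U D j ∩ countEq U D i n) := by
  classical
  have key : downAt U D j ∩ countEq U D i n =
      (⋃ k ∈ {k | k < i}, countEq U D k j ∩ D k) ∩ countEq U D i n := by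
    ext ω
    simp only [downAt, Set.mem_inter_iff, Set.mem_iUnion, Set.mem_ofPred_eq, exists_prop]
    refine and_congr_left fun hn => ⟨?_, fun ⟨k, _, h⟩ => ⟨k, h⟩⟩
    rintro ⟨k, hk, hD⟩
    refine ⟨k, ?_, hk, hD⟩
    by_contra! hik
    have := Nat.count_monotone (fun k => ω ∈ U k ∪ D k) hik
    rw [show Nat.count _ i = n from hn, show Nat.count _ k = j from hk] at this
    omega
  rw [key]
  refine (MeasurableSet.biUnion (Set.to_countable _) fun k hk => ?_).inter
    (measurableSet_countEq hU hD i n)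
  exact G.mono (show k + 1 ≤ i from hk) _
    ((G.mono k.le_succ _ (measurableSet_countEq hU hD k j)).inter (hD k))

lemma measurableSet_downAt (hU : ∀ i, MeasurableSet[G (i + 1)] (U i))
    (hD : ∀ i, MeasurableSet[G (i + 1)] (D i)) (n : ℕ) : MeasurableSet (downAt U D n) :=
  MeasurableSet.iUnion fun i =>
    (G.le i _ (measurableSet_countEq hU hD i n)).inter (G.le _ _ (hD i))

variable {μ : Measure Ω} [IsProbabilityMeasure μ] {r : ℝ≥0∞}

/-- If each mark occurs with the same positive conditional probability given the past, then almost
surely infinitely many marks occur: the probability `c` that none occurs from time `i` on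
satisfies `c = c + c r`. -/
lemma ae_infinite_of_measure_inter_eq (hr : r ≠ 0) {E : ℕ → Set Ω}
    (hE : ∀ i, MeasurableSet[G (i + 1)] (E i))
    (hEr : ∀ i F, MeasurableSet[G i] F → μ (F ∩ E i) = μ F * r) :
    ∀ᵐ ω ∂μ, {i | ω ∈ E i}.Infinite := by
  have hE' : ∀ i, MeasurableSet (E i) := fun i => G.le _ _ (hE i)
  have key : ∀ i, μ (⋂ n, (E (i + n))ᶜ) = 0 := by
    intro i
    set F : ℕ → Set Ω := fun n => ⋂ k ∈ {k | k < n}, (E (i + k))ᶜ with hF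
    have hFm : ∀ n, MeasurableSet[G (i + n)] (F n) := fun n =>
      MeasurableSet.biInter (Set.to_countable _) fun k hk =>
        (G.mono (by simp at hk; omega) _ (hE (i + k))).compl
    have hFanti : Antitone F := fun a b hab =>
      Set.biInter_mono (fun k hk => lt_of_lt_of_le hk hab) fun _ _ => subset_rfl
    have hInter : ⋂ n, (E (i + n))ᶜ = ⋂ n, F n := by
      ext ω
      simp only [hF, Set.mem_iInter, Set.mem_ofPred_eq]
      exact ⟨fun h _ k _ => h k, fun h n => h (n + 1) n n.lt_succ_self⟩
    have hlim : Filter.Tendsto (fun n => μ (F n)) Filter.atTop (nhds (μ (⋂ n, F n))) :=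
      tendsto_measure_iInter_atTop (fun n => (G.le _ _ (hFm n)).nullMeasurableSet) hFanti
        ⟨0, measure_ne_top _ _⟩
    have hstep : ∀ n, μ (F n) = μ (F (n + 1)) + μ (F n) * r := by
      intro n
      rw [← hEr _ _ (hFm n), ← measure_sdiff_add_inter (F n) (hE' (i + n))]
      congr 2
      ext ω
      simp only [hF, Set.mem_sdiff, Set.mem_iInter, Set.mem_ofPred_eq, Set.mem_compl_iff]
      refine ⟨fun h k hk => ?_, fun h => ⟨fun k hk => h k (by omega), h n (by omega)⟩⟩
      rcases Nat.lt_succ_iff_lt_or_eq.1 hk with hk | rfl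
      exacts [h.1 k hk, h.2]
    have hrt : r ≠ ∞ := by
      have := hEr 0 Set.univ MeasurableSet.univ
      rw [measure_univ, one_mul] at this
      exact this ▸ measure_ne_top _ _
    have hlim2 := (hlim.comp (Filter.tendsto_add_atTop_nat 1)).add
      (ENNReal.Tendsto.mul_const hlim (Or.inr hrt))
    have heq := tendsto_nhds_unique hlim (hlim2.congr fun n => (hstep n).symm)
    rw [hInter]
    by_contra hne
    have h0 : μ (⋂ n, F n) * r = 0 := by
      have : μ (⋂ n, F n) + 0 = μ (⋂ n, F n) + μ (⋂ n, F n) * r := by rw [add_zero]; exact heq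
      exact ((ENNReal.add_right_inj (measure_ne_top _ _)).1 this).symm
    rcases mul_eq_zero.1 h0 with h | h
    exacts [hne h, hr h]
  have hall : ∀ᵐ ω ∂μ, ∀ i, ω ∉ ⋂ n, (E (i + n))ᶜ :=
    ae_all_iff.2 fun i => measure_eq_zero_iff_ae_notMem.1 (key i)
  filter_upwards [hall] with ω hω
  refine Set.infinite_of_not_bddAbove fun ⟨b, hb⟩ => hω (b + 1) ?_
  refine Set.mem_iInter.2 fun n hn => ?_
  have := hb (show b + 1 + n ∈ {i | ω ∈ E i} from hn)
  omega

variable (hU : ∀ i, MeasurableSet[G (i + 1)] (U i)) (hD : ∀ i, MeasurableSet[G (i + 1)] (D i))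
  (hdisj : ∀ i, Disjoint (U i) (D i)) (hr : r ≠ 0)
  (hUr : ∀ i F, MeasurableSet[G i] F → μ (F ∩ U i) = μ F * r)
  (hDr : ∀ i F, MeasurableSet[G i] F → μ (F ∩ D i) = μ F * r)

include hU hD hdisj hr hUr hDr

lemma ae_infinite_marks : ∀ᵐ ω ∂μ, {i | ω ∈ U i ∪ D i}.Infinite := by
  refine ae_infinite_of_measure_inter_eq (r := r + r) (by simpa using hr) (fun i => (hU i).union (hD i))
    fun i F hF => ?_
  rw [Set.inter_union_distrib_left, measure_union ((hdisj i).mono Set.inter_subset_right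
    Set.inter_subset_right) ((G.le _ _ hF).inter (G.le _ _ (hD i))), hUr i F hF, hDr i F hF,
    mul_add]

/-- The probability of an event `A` determined by the first `n` marks is halved by intersecting
it with the event that mark `n` is of type `D`, since at each possible time of mark `n` both types
are equally likely given the past. -/
lemma measure_inter_downAt {A : Set Ω} {n : ℕ} (hAm : MeasurableSet A)
    (hA : ∀ i, MeasurableSet[G i] (A ∩ countEq U D i n)) :
    μ (A ∩ downAt U D n) = μ A * 2⁻¹ := by
  classical
  have hinf := ae_infinite_marks hU hD hdisj hr hUr hDr
  have hsum : ∀ s : ℕ → Set Ω, (∀ i, s i ⊆ U i ∪ D i) → (∀ i, MeasurableSet[G (i + 1)] (s i)) →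
      (∀ i F, MeasurableSet[G i] F → μ (F ∩ s i) = μ F * r) →
      μ (A ∩ ⋃ i, countEq U D i n ∩ s i) = ∑' i, μ (A ∩ countEq U D i n) * r := by
    intro s hs hsm hsr
    rw [Set.inter_iUnion, measure_iUnion]
    · exact tsum_congr fun i => by rw [← Set.inter_assoc, hsr i _ (hA i)]
    · intro i j hij
      exact (pairwise_disjoint_countEq_inter n hs hij).mono Set.inter_subset_right
        Set.inter_subset_right
    · exact fun i => hAm.inter ((G.le _ _ (measurableSet_countEq hU hD i n)).inter
        (G.le _ _ (hsm i)))
  have h1 := hsum D (fun i => Set.subset_union_right) hD hDr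
  have h2 := hsum U (fun i => Set.subset_union_left) hU hUr
  have hdiff : (A \ downAt U D n : Set Ω) =ᵐ[μ] (A ∩ ⋃ i, countEq U D i n ∩ U i : Set Ω) := by
    filter_upwards [hinf] with ω hω
    refine propext (and_congr_right fun _ => ?_)
    have e : (⋃ i, countEq U D i n ∩ U i) = downAt D U n := by
      simp only [downAt, countEq_swap]
    have hω' : {i | ω ∈ D i ∪ U i}.Infinite := by simpa only [Set.union_comm] using hω
    rw [e, mem_downAt_iff hω, mem_downAt_iff hω']
    simp only [Set.union_comm (D _)]
    have hmem : ω ∈ U _ ∪ D _ := Nat.nth_mem_of_infinite hω n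
    exact ⟨fun h => hmem.resolve_right h, fun h => Set.disjoint_left.1 (hdisj _) h⟩
  have hsplit := measure_inter_add_sdiff (μ := μ) A (measurableSet_downAt hU hD n)
  rw [measure_congr hdiff, h2, ← h1] at hsplit
  change μ (A ∩ downAt U D n) + μ (A ∩ downAt U D n) = μ A at hsplit
  rw [← hsplit, ← two_mul, mul_comm, ← mul_assoc, ENNReal.inv_mul_cancel (by simp) (by simp),
    one_mul]

lemma measure_downAt (n : ℕ) : μ (downAt U D n) = 2⁻¹ := by
  have := measure_inter_downAt hU hD hdisj hr hUr hDr (A := Set.univ) (n := n) .univ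
    fun i => by simpa using measurableSet_countEq hU hD i n
  simpa using this

/-- The types of the successive marks are independent. -/
lemma iIndepSet_downAt : iIndepSet (downAt U D) μ := by
  refine (iIndepSet_iff_meas_biInter (measurableSet_downAt hU hD)).2 fun S => ?_
  simp only [measure_downAt hU hD hdisj hr hUr hDr, Finset.prod_const]
  induction S using Finset.induction_on_max with
  | empty => simp
  | insert n S hn ih =>
    have hnS : n ∉ S := fun h => lt_irrefl _ (hn n h)
    rw [Finset.card_insert_of_notMem hnS, pow_succ, ← ih, Finset.set_biInter_insert,
      Set.inter_comm]
    refine measure_inter_downAt hU hD hdisj hr hUr hDr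
      (S.measurableSet_biInter fun j _ => measurableSet_downAt hU hD j) fun i => ?_
    have e : (⋂ j ∈ S, downAt U D j) ∩ countEq U D i n =
        (⋂ j ∈ S, (downAt U D j ∩ countEq U D i n)) ∩ countEq U D i n := by
      ext ω
      simp only [Set.mem_inter_iff, Set.mem_iInter]
      exact ⟨fun h => ⟨fun j hj => ⟨h.1 j hj, h.2⟩, h.2⟩, fun h => ⟨fun j hj => (h.1 j hj).1, h.2⟩⟩
    rw [e]
    exact (S.measurableSet_biInter fun j hj =>
      measurableSet_downAt_inter_countEq hU hD (hn j hj) i).inter (measurableSet_countEq hU hD i n)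

end Marks

/-! ### Crossing times of continuous paths -/

section Paths

variable {Ω : Type*} {X : ℝ≥0 → Ω → ℝ} {δ : ℝ} {l : ℤ} {j : ℕ} {ω : Ω}

lemma crossingTime_succ_eq_sInf_image {s : ℝ≥0} (hs : crossingTime X δ l j ω = s) :
    crossingTime X δ l (j + 1) ω =
      sInf ((↑) '' {u : ℝ≥0 | s < u ∧ |X u ω - X s ω| = (2 : ℝ) ^ l * δ}) := by
  rw [crossingTime]
  congr 1
  ext t
  simp only [Set.mem_ofPred_eq, Set.mem_image, hs, WithTop.coe_inj]
  constructor
  · rintro ⟨_, u, rfl, rfl, h⟩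
    exact ⟨u, h, rfl⟩
  · rintro ⟨u, h, rfl⟩
    exact ⟨s, u, rfl, rfl, h⟩

lemma crossingTime_ne_top_of_succ (h : crossingTime X δ l (j + 1) ω ≠ ⊤) :
    crossingTime X δ l j ω ≠ ⊤ := by
  contrapose! h
  rw [crossingTime, sInf_eq_top]
  rintro t ⟨s, u, hs, -⟩
  exact absurd (h.symm.trans hs) WithTop.top_ne_coe

lemma crossingTime_succ_eq_coe {s u : ℝ≥0} (hs : crossingTime X δ l j ω = s)
    (hu : IsLeast {u : ℝ≥0 | s < u ∧ |X u ω - X s ω| = (2 : ℝ) ^ l * δ} u) :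
    crossingTime X δ l (j + 1) ω = u := by
  rw [crossingTime_succ_eq_sInf_image hs]
  refine IsLeast.csInf_eq ⟨Set.mem_image_of_mem _ hu.1, ?_⟩
  rintro _ ⟨v, hv, rfl⟩
  exact WithTop.coe_le_coe.2 (hu.2 hv)

/-- Along a continuous path a finite crossing time is attained. -/
lemma exists_isLeast_of_crossingTime_succ_ne_top (hδ : 0 < δ) (hX : Continuous fun t => X t ω)
    (h : crossingTime X δ l (j + 1) ω ≠ ⊤) :
    ∃ s u : ℝ≥0, crossingTime X δ l j ω = s ∧ crossingTime X δ l (j + 1) ω = u ∧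
      IsLeast {u : ℝ≥0 | s < u ∧ |X u ω - X s ω| = (2 : ℝ) ^ l * δ} u := by
  obtain ⟨s, hs⟩ := WithTop.ne_top_iff_exists.1 (crossingTime_ne_top_of_succ h)
  set S := {u : ℝ≥0 | s < u ∧ |X u ω - X s ω| = (2 : ℝ) ^ l * δ} with hS
  have hc : 0 < (2 : ℝ) ^ l * δ := by positivity
  have hne : S.Nonempty := by
    by_contra hne
    rw [Set.not_nonempty_iff_eq_empty] at hne
    rw [crossingTime_succ_eq_sInf_image hs.symm, ← hS, hne] at h
    simp at h
  -- As `X u = X s` at `u = s`, the strict inequality `s < u` may be relaxed.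
  have hS' : S = {u : ℝ≥0 | s ≤ u} ∩ {u | |X u ω - X s ω| = (2 : ℝ) ^ l * δ} := by
    ext u
    refine ⟨fun h => ⟨h.1.le, h.2⟩, fun h => ⟨lt_of_le_of_ne h.1 ?_, h.2⟩⟩
    rintro rfl
    have := h.2
    simp only [Set.mem_ofPred_eq, sub_self, abs_zero] at this
    exact hc.ne this
  have hcl : IsClosed S := by
    rw [hS']
    exact (isClosed_le continuous_const continuous_id).inter
      (isClosed_eq (hX.sub continuous_const).abs continuous_const)
  have hl : IsLeast S (sInf S) :=
    ⟨hcl.csInf_mem hne (OrderBot.bddBelow S), fun v hv => csInf_le (OrderBot.bddBelow S) hv⟩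
  exact ⟨s, sInf S, hs.symm, crossingTime_succ_eq_coe hs.symm hl, hl⟩

lemma crossingTime_le_succ (hδ : 0 < δ) (hX : Continuous fun t => X t ω) :
    crossingTime X δ l j ω ≤ crossingTime X δ l (j + 1) ω := by
  by_cases h : crossingTime X δ l (j + 1) ω = ⊤
  · simp [h]
  · obtain ⟨s, u, hs, hu, hl⟩ := exists_isLeast_of_crossingTime_succ_ne_top hδ hX h
    rw [hs, hu]
    exact WithTop.coe_le_coe.2 hl.1.1.le

lemma crossingPoint_eq {u : ℝ≥0} (hu : crossingTime X δ l j ω = u) :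
    crossingPoint X δ l j ω = X u ω := by
  rw [crossingPoint, stoppedValue, hu]
  rfl

/-- A crossing has size `2 ^ l * δ`. -/
lemma abs_crossingPoint_succ_sub (hδ : 0 < δ) (hX : Continuous fun t => X t ω)
    (h : crossingTime X δ l (j + 1) ω ≠ ⊤) :
    |crossingPoint X δ l (j + 1) ω - crossingPoint X δ l j ω| = (2 : ℝ) ^ l * δ := by
  obtain ⟨s, u, hs, hu, hl⟩ := exists_isLeast_of_crossingTime_succ_ne_top hδ hX h
  rw [crossingPoint_eq hs, crossingPoint_eq hu]
  exact hl.1.2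

/-- By continuity the next crossing is completed by time `t` iff the path gets arbitrarily close
to distance `2 ^ l * δ` at times from a given dense sequence, clamped to the interval between the
current crossing time and `t`. -/
lemma crossingTime_succ_le_iff (hδ : 0 < δ) (hX : Continuous fun t => X t ω) {d : ℕ → ℝ≥0}
    (hd : DenseRange d) (t : ℝ≥0) :
    crossingTime X δ l (j + 1) ω ≤ t ↔ crossingTime X δ l j ω ≤ t ∧ ∀ n : ℕ, ∃ k,
      (2 : ℝ) ^ l * δ - 1 / ((n : ℝ) + 1) <
        |stoppedValue X (fun ω => min (max (crossingTime X δ l j ω) (d k : WithTop ℝ≥0)) t) ω -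
          stoppedValue X (fun ω => min (crossingTime X δ l j ω) (t : WithTop ℝ≥0)) ω| := by
  have hc : 0 < (2 : ℝ) ^ l * δ := by positivity
  have hval : ∀ s : ℝ≥0, s ≤ t → crossingTime X δ l j ω = s → ∀ q : ℝ≥0,
      |stoppedValue X (fun ω => min (max (crossingTime X δ l j ω) (q : WithTop ℝ≥0)) t) ω -
          stoppedValue X (fun ω => min (crossingTime X δ l j ω) (t : WithTop ℝ≥0)) ω| =
        |X (min (max s q) t) ω - X s ω| := by
    intro s hst hs q
    simp only [stoppedValue, hs, ← WithTop.coe_max, ← WithTop.coe_min, min_eq_left hst]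
    rfl
  have hcont : ∀ s : ℝ≥0, Continuous fun q => |X (min (max s q) t) ω - X s ω| := fun s =>
    ((hX.comp ((continuous_const.max continuous_id).min continuous_const)).sub
      continuous_const).abs
  constructor
  · intro h
    obtain ⟨s, u, hs, hu, hl⟩ := exists_isLeast_of_crossingTime_succ_ne_top hδ hX
      (ne_top_of_le_ne_top WithTop.coe_ne_top h)
    have hut : u ≤ t := by rw [hu] at h; exact WithTop.coe_le_coe.1 h
    have hst : s ≤ t := hl.1.1.le.trans hut
    refine ⟨by rw [hs]; exact WithTop.coe_le_coe.2 hst, fun n => ?_⟩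
    simp_rw [hval s hst hs]
    refine hd.exists_mem_open (isOpen_lt continuous_const (hcont s)) ⟨u, ?_⟩
    rw [Set.mem_ofPred_eq, max_eq_right hl.1.1.le, min_eq_left hut, hl.1.2]
    have : (0 : ℝ) < 1 / ((n : ℝ) + 1) := by positivity
    linarith
  · rintro ⟨h, hn⟩
    obtain ⟨s, hs⟩ := WithTop.ne_top_iff_exists.1 (ne_top_of_le_ne_top WithTop.coe_ne_top h)
    have hst : s ≤ t := by rw [← hs] at h; exact WithTop.coe_le_coe.1 h
    simp_rw [hval s hst hs.symm] at hn
    obtain ⟨v, hv, hmax⟩ := isCompact_Icc.exists_isMaxOn (Set.nonempty_Icc.2 hst)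
      ((hX.sub continuous_const).abs.continuousOn (f := fun q => |X q ω - X s ω|))
    have hvc : (2 : ℝ) ^ l * δ ≤ |X v ω - X s ω| := by
      refine le_of_tendsto' (f := fun n : ℕ => (2 : ℝ) ^ l * δ - 1 / ((n : ℝ) + 1))
        (x := Filter.atTop) ?_ fun n => ?_
      · simpa using tendsto_const_nhds.sub (tendsto_one_div_add_atTop_nhds_zero_nat (𝕜 := ℝ))
      · obtain ⟨k, hk⟩ := hn n
        exact hk.le.trans (hmax (show min (max s (d k)) t ∈ Set.Icc s t from
          ⟨le_min (le_max_left _ _) hst, min_le_right _ _⟩))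
    obtain ⟨u, hu, huc⟩ := intermediate_value_Icc hv.1
      ((hX.sub continuous_const).abs.continuousOn (f := fun q => |X q ω - X s ω|))
      (show (2 : ℝ) ^ l * δ ∈ Set.Icc |X s ω - X s ω| |X v ω - X s ω| from
        ⟨by simpa using hc.le, hvc⟩)
    have hsu : s < u := lt_of_le_of_ne hu.1 fun e => by
      subst e
      simp only [sub_self, abs_zero] at huc
      exact hc.ne huc
    rw [crossingTime_succ_eq_sInf_image hs.symm]
    refine (sInf_le (Set.mem_image_of_mem _ (show u ∈ {u : ℝ≥0 | s < u ∧
      |X u ω - X s ω| = (2 : ℝ) ^ l * δ} from ⟨hsu, huc⟩))).trans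
      (WithTop.coe_le_coe.2 (hu.2.trans hv.2))

end Paths

section StoppingTime

variable {Ω : Type*} {mΩ : MeasurableSpace Ω} {𝓕 : Filtration ℝ≥0 mΩ} {X : ℝ≥0 → Ω → ℝ} {δ : ℝ}
  {l : ℤ}

lemma isStronglyProgressive_of_adapted (hc : ∀ ω, Continuous fun t => X t ω) (hX : Adapted 𝓕 X) :
    IsStronglyProgressive 𝓕 X :=
  StronglyAdapted.isStronglyProgressive_of_continuous (fun t => (hX t).stronglyMeasurable) hc

/-- Crossing times are stopping times. No right-continuity of the filtration is needed, as they are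
hitting times of closed sets. -/
lemma isStoppingTime_crossingTime (hδ : 0 < δ) (hc : ∀ ω, Continuous fun t => X t ω)
    (hX : Adapted 𝓕 X) (j : ℕ) : IsStoppingTime 𝓕 (crossingTime X δ l j) := by
  induction j with
  | zero => exact isStoppingTime_const 𝓕 0
  | succ j ih =>
    intro t
    have hp := isStronglyProgressive_of_adapted hc hX
    have e : {ω | crossingTime X δ l (j + 1) ω ≤ t} = {ω | crossingTime X δ l j ω ≤ t} ∩
        ⋂ n : ℕ, ⋃ k, {ω | (2 : ℝ) ^ l * δ - 1 / ((n : ℝ) + 1) <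
          |stoppedValue X (fun ω => min (max (crossingTime X δ l j ω)
              (TopologicalSpace.denseSeq ℝ≥0 k : WithTop ℝ≥0)) t) ω -
            stoppedValue X (fun ω => min (crossingTime X δ l j ω) (t : WithTop ℝ≥0)) ω|} := by
      ext ω
      simp only [Set.mem_ofPred_eq, Set.mem_inter_iff, Set.mem_iInter, Set.mem_iUnion]
      exact crossingTime_succ_le_iff hδ (hc ω) (TopologicalSpace.denseRange_denseSeq ℝ≥0) t
    rw [e]
    refine (ih t).inter (MeasurableSet.iInter fun n => MeasurableSet.iUnion fun k => ?_)
    have h1 : StronglyMeasurable[𝓕 t] (stoppedValue X fun ω => min (max (crossingTime X δ l j ω)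
        (TopologicalSpace.denseSeq ℝ≥0 k : WithTop ℝ≥0)) t) :=
      stronglyMeasurable_stoppedValue_of_le hp ((ih.max_const _).min_const t)
        fun _ => min_le_right _ _
    have h2 : StronglyMeasurable[𝓕 t]
        (stoppedValue X fun ω => min (crossingTime X δ l j ω) (t : WithTop ℝ≥0)) :=
      stronglyMeasurable_stoppedValue_of_le hp (ih.min_const t) fun _ => min_le_right _ _
    exact measurableSet_lt measurable_const (h1.sub h2).norm.measurable

lemma measurable_crossingPoint (hδ : 0 < δ) (hc : ∀ ω, Continuous fun t => X t ω)
    (hX : ∀ t, Measurable (X t)) (j : ℕ) : Measurable (crossingPoint X δ l j) := by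
  have hX' : Adapted (⊤ : Filtration ℝ≥0 mΩ) X := hX
  exact (measurable_stoppedValue (isStronglyProgressive_of_adapted hc hX')
    (isStoppingTime_crossingTime hδ hc hX' j)).mono (IsStoppingTime.measurableSpace_le _) le_rfl

end StoppingTime

section Shift

/-- The space of continuous paths, with the `σ`-algebra generated by the coordinates. -/
abbrev PathSpace : Type := {y : ℝ≥0 → ℝ // Continuous y}

/-- The coordinate process on path space. -/
def coord (t : ℝ≥0) (y : PathSpace) : ℝ := y.1 t

variable {Ω : Type*} {X : ℝ≥0 → Ω → ℝ} {δ : ℝ} {l : ℤ} {j : ℕ} {ω : Ω}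

/-- The end point of a crossing is the first crossing point of the path after the start of the
crossing. -/
lemma crossingPoint_coord_one (hδ : 0 < δ) (hX : Continuous fun t => X t ω)
    (h : crossingTime X δ l (j + 1) ω ≠ ⊤) {y : PathSpace}
    (hy : ∀ t, y.1 t = X ((crossingTime X δ l j ω).untopA + t) ω) :
    crossingPoint coord δ l 1 y = crossingPoint X δ l (j + 1) ω := by
  obtain ⟨s, u, hs, hu, hl⟩ := exists_isLeast_of_crossingTime_succ_ne_top hδ hX h
  rw [hs] at hy
  change ∀ t, y.1 t = X (s + t) ω at hy
  have hsu : s + (u - s) = u := add_tsub_cancel_of_le hl.1.1.le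
  have h1 : crossingTime coord δ l 1 y = (u - s : ℝ≥0) := by
    refine crossingTime_succ_eq_coe (s := 0) rfl ⟨⟨tsub_pos_of_lt hl.1.1, ?_⟩, fun v hv => ?_⟩
    · simp only [coord, hy, hsu, add_zero]
      exact hl.1.2
    · refine tsub_le_iff_left.2 (hl.2 ⟨lt_add_of_pos_right s hv.1, ?_⟩)
      simpa only [coord, hy, add_zero] using hv.2
  rw [crossingPoint_eq h1, crossingPoint_eq hu, coord, hy, hsu]

end Shift

/-! ### The strong Markov property for the future path -/

section StrongMarkov

variable {Ω : Type*} {mΩ : MeasurableSpace Ω} {μ : Measure Ω}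
  {𝓕 : Filtration ℝ≥0 mΩ} {X : ℝ≥0 → Ω → ℝ} {τ : Ω → WithTop ℝ≥0}

lemma isStoppingTime_add_coe (hτ : IsStoppingTime 𝓕 τ) (t : ℝ≥0) :
    IsStoppingTime 𝓕 fun ω => τ ω + (t : WithTop ℝ≥0) := by
  intro u
  by_cases htu : t ≤ u
  · have e : {ω | τ ω + (t : WithTop ℝ≥0) ≤ u} = {ω | τ ω ≤ (u - t : ℝ≥0)} := by
      ext ω
      simp only [Set.mem_ofPred_eq]
      cases τ ω with
      | top =>
        rw [top_add]
        simp only [top_le_iff, WithTop.coe_ne_top]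
      | coe s =>
        rw [← WithTop.coe_add, WithTop.coe_le_coe, WithTop.coe_le_coe, le_tsub_iff_right htu]
    rw [e]
    exact 𝓕.mono tsub_le_self _ (hτ (u - t))
  · have e : {ω | τ ω + (t : WithTop ℝ≥0) ≤ u} = ∅ := by
      refine Set.eq_empty_of_forall_notMem fun ω (h : τ ω + (t : WithTop ℝ≥0) ≤ u) => htu ?_
      exact WithTop.coe_le_coe.1 (le_add_self.trans h)
    rw [e]
    exact @MeasurableSet.empty _ (𝓕 u)

lemma IsContinuousStrongMarkov.isStronglyProgressive (hX : IsContinuousStrongMarkov μ 𝓕 X) :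
    IsStronglyProgressive 𝓕 X :=
  isStronglyProgressive_of_adapted hX.continuous_paths hX.adapted

lemma IsContinuousStrongMarkov.measurable_stoppedValue (hX : IsContinuousStrongMarkov μ 𝓕 X)
    (hτ : IsStoppingTime 𝓕 τ) : Measurable (stoppedValue X τ) :=
  (MeasureTheory.measurable_stoppedValue hX.isStronglyProgressive hτ).mono
    (IsStoppingTime.measurableSpace_le _) le_rfl

/-- The path of `X` after the time `τ`. -/
noncomputable def futurePath (hc : ∀ ω, Continuous fun t => X t ω) (τ : Ω → WithTop ℝ≥0) (ω : Ω) : PathSpace :=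
  ⟨fun t => X ((τ ω).untopA + t) ω, (hc ω).comp (continuous_const.add continuous_id)⟩

lemma measurable_futurePath (hX : IsContinuousStrongMarkov μ 𝓕 X) (hτ : IsStoppingTime 𝓕 τ) :
    Measurable (futurePath hX.continuous_paths τ) := by
  refine Measurable.subtype_mk (measurable_pi_lambda _ fun t => ?_)
  have hu : Measurable (Function.uncurry X) :=
    measurable_uncurry_of_continuous_of_measurable hX.continuous_paths
      fun t => (hX.adapted t).mono (𝓕.le t) le_rfl
  exact hu.comp ((hτ.measurable'.untopA.add_const t).prodMk measurable_id)

variable [IsProbabilityMeasure μ]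

/-- The strong Markov property, integrated over an event of the past. -/
lemma IsContinuousStrongMarkov.exists_kernel (hX : IsContinuousStrongMarkov μ 𝓕 X) :
    ∃ κ : ℝ≥0 → Kernel ℝ ℝ, ∀ (τ : Ω → WithTop ℝ≥0) (hτ : IsStoppingTime 𝓕 τ),
      (∀ᵐ ω ∂μ, τ ω ≠ ⊤) → ∀ (t : ℝ≥0) (F : Set Ω), MeasurableSet[hτ.measurableSpace] F →
      ∀ f : ℝ → ℝ≥0∞, Measurable f →
        ∫⁻ ω in F, f (stoppedValue X (fun ω => τ ω + (t : WithTop ℝ≥0)) ω) ∂μ =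
          ∫⁻ ω in F, ∫⁻ y, f y ∂(κ t (stoppedValue X τ ω)) ∂μ := by
  obtain ⟨κ, hκ, hM⟩ := hX.strong_markov
  refine ⟨κ, fun τ hτ hfin t F hF f hf => ?_⟩
  have := hκ.isMarkov t
  have hFm : MeasurableSet F := hτ.measurableSpace_le _ hF
  have hm := hX.measurable_stoppedValue hτ
  have hmt := hX.measurable_stoppedValue (isStoppingTime_add_coe hτ t)
  have key : (μ.restrict F).map (stoppedValue X (fun ω => τ ω + (t : WithTop ℝ≥0))) =
      ((μ.restrict F).map (stoppedValue X τ)).bind (κ t) := by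
    ext A hA
    rw [Measure.map_apply hmt hA, Measure.bind_apply hA (κ t).aemeasurable,
      lintegral_map ((κ t).measurable_coe hA) hm]
    set S : Set Ω := {ω | τ ω ≠ ⊤ ∧
      stoppedValue X (fun ω => τ ω + (t : WithTop ℝ≥0)) ω ∈ A} with hS
    have hSm : MeasurableSet S := hτ.measurableSet_eq_top.compl.inter (hmt hA)
    have hint : Integrable (S.indicator fun _ => (1 : ℝ)) μ :=
      (integrable_const 1).indicator hSm
    have h1 := setIntegral_condExp (hτ.measurableSpace_le) hint hF
    have h2 : ∫ ω in F, (μ[S.indicator fun _ => (1 : ℝ) | hτ.measurableSpace]) ω ∂μ =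
        ∫ ω in F, (κ t (stoppedValue X τ ω)).real A ∂μ := by
      refine integral_congr_ae (ae_restrict_of_ae ?_)
      filter_upwards [hM τ hτ t A hA, hfin] with ω h hω
      rw [h, Set.indicator_of_mem (show ω ∈ {ω | τ ω ≠ ⊤} from hω)]
    have h3 : ∫ ω in F, S.indicator (fun _ => (1 : ℝ)) ω ∂μ = (μ.restrict F).real S := by
      rw [integral_indicator hSm]; simp
    have h4 : ∫ ω in F, (κ t (stoppedValue X τ ω)).real A ∂μ =
        (∫⁻ ω in F, κ t (stoppedValue X τ ω) A ∂μ).toReal := by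
      simp only [Measure.real]
      exact integral_toReal (((κ t).measurable_coe hA).comp hm).aemeasurable
        (Filter.Eventually.of_forall fun ω => measure_lt_top _ _)
    have h5 : (∫⁻ ω in F, κ t (stoppedValue X τ ω) A ∂μ) ≠ ∞ := by
      refine ne_top_of_le_ne_top (measure_ne_top (μ.restrict F) Set.univ) ?_
      rw [← lintegral_one]
      exact lintegral_mono fun ω => prob_le_one
    rw [h2, h3, h4, Measure.real, ENNReal.toReal_eq_toReal_iff' h5 (by finiteness)] at h1
    rw [h1]
    refine measure_congr (ae_restrict_of_ae ?_)
    filter_upwards [hfin] with ω hω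
    exact propext ⟨fun h => ⟨hω, h⟩, fun h => h.2⟩
  calc ∫⁻ ω in F, f (stoppedValue X (fun ω => τ ω + (t : WithTop ℝ≥0)) ω) ∂μ
      = ∫⁻ y, f y ∂((μ.restrict F).map (stoppedValue X (fun ω => τ ω + (t : WithTop ℝ≥0)))) :=
        (lintegral_map hf hmt).symm
    _ = _ := by
      rw [key, Measure.lintegral_bind (κ t).aemeasurable hf.aemeasurable,
        lintegral_map hf.lintegral_kernel hm]

/-- Finite-dimensional distributions of the future at times `τ + i`, `i ≥ a`: given the past of
`τ + a` they depend on `X (τ + a)` only, through a function that is the same for all `τ`. -/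
lemma IsContinuousStrongMarkov.exists_measure_inter_eq (hX : IsContinuousStrongMarkov μ 𝓕 X)
    (I : Finset ℝ≥0) {A : ℝ≥0 → Set ℝ} (hA : ∀ i, MeasurableSet (A i)) (a : ℝ≥0)
    (ha : ∀ i ∈ I, a ≤ i) :
    ∃ h : ℝ → ℝ≥0∞, Measurable h ∧ ∀ (τ : Ω → WithTop ℝ≥0) (hτ : IsStoppingTime 𝓕 τ),
      (∀ᵐ ω ∂μ, τ ω ≠ ⊤) →
      ∀ F : Set Ω, MeasurableSet[(isStoppingTime_add_coe hτ a).measurableSpace] F →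
        μ (F ∩ ⋂ i ∈ I, stoppedValue X (fun ω => τ ω + (i : WithTop ℝ≥0)) ⁻¹' A i) =
          ∫⁻ ω in F, h (stoppedValue X (fun ω => τ ω + (a : WithTop ℝ≥0)) ω) ∂μ := by
  obtain ⟨κ, hκ⟩ := hX.exists_kernel
  induction I using Finset.induction_on_min generalizing a with
  | empty => exact ⟨fun _ => 1, measurable_const, fun τ hτ _ F _ => by simp⟩
  | insert b I hb ih =>
    obtain ⟨h, hh, hI⟩ := ih b fun i hi => (hb i hi).le
    have hab : a ≤ b := ha b (Finset.mem_insert_self b I)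
    have hf : Measurable ((A b).indicator h) := hh.indicator (hA b)
    refine ⟨fun x => ∫⁻ y, (A b).indicator h y ∂(κ (b - a) x), hf.lintegral_kernel,
      fun τ hτ hfin F hF => ?_⟩
    have hτa := isStoppingTime_add_coe hτ a
    have hτb := isStoppingTime_add_coe hτ b
    have hm := MeasureTheory.measurable_stoppedValue hX.isStronglyProgressive hτb
    have hFb : MeasurableSet[hτb.measurableSpace] F :=
      IsStoppingTime.measurableSpace_mono hτa hτb
        (fun ω => add_le_add_right (WithTop.coe_le_coe.2 hab) _) _ hF
    have eb : (fun ω => τ ω + (a : WithTop ℝ≥0) + ((b - a : ℝ≥0) : WithTop ℝ≥0)) =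
        fun ω => τ ω + (b : WithTop ℝ≥0) := by
      funext ω
      rw [add_assoc, ← WithTop.coe_add, add_tsub_cancel_of_le hab]
    have hfina : ∀ᵐ ω ∂μ, τ ω + (a : WithTop ℝ≥0) ≠ ⊤ := by
      filter_upwards [hfin] with ω hω
      exact WithTop.add_ne_top.2 ⟨hω, WithTop.coe_ne_top⟩
    have h1 := hκ _ hτa hfina (b - a) F hF _ hf
    rw [eb] at h1
    rw [← h1, Finset.set_biInter_insert, ← Set.inter_assoc,
      hI τ hτ hfin _ (hFb.inter (hm (hA b)))]
    have hms : MeasurableSet (stoppedValue X (fun ω => τ ω + (b : WithTop ℝ≥0)) ⁻¹' A b) :=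
      hX.measurable_stoppedValue hτb (hA b)
    rw [Set.inter_comm, ← setLIntegral_indicator hms]
    rfl

/-- Given the value of `X τ`, the path after `τ` is independent of the past: two events of the past
on which `X τ` takes one and the same value `x` assign the same law to it. -/
lemma IsContinuousStrongMarkov.measure_inter_futurePath_mul
    (hX : IsContinuousStrongMarkov μ 𝓕 X) (hτ : IsStoppingTime 𝓕 τ) (hfin : ∀ᵐ ω ∂μ, τ ω ≠ ⊤)
    {x : ℝ} {F H : Set Ω} (hF : MeasurableSet[hτ.measurableSpace] F)
    (hH : MeasurableSet[hτ.measurableSpace] H) (hFx : ∀ ω ∈ F, stoppedValue X τ ω = x)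
    (hHx : ∀ ω ∈ H, stoppedValue X τ ω = x) {B : Set PathSpace} (hB : MeasurableSet B) :
    μ (F ∩ futurePath hX.continuous_paths τ ⁻¹' B) * μ H =
      μ (H ∩ futurePath hX.continuous_paths τ ⁻¹' B) * μ F := by
  have hY := measurable_futurePath hX hτ
  set Y := futurePath hX.continuous_paths τ
  have hFm : MeasurableSet F := hτ.measurableSpace_le _ hF
  have hHm : MeasurableSet H := hτ.measurableSpace_le _ hH
  have hap : ∀ (G K : Set Ω), MeasurableSet G → ∀ B, MeasurableSet B →
      (μ K • (μ.restrict G).map Y) B = μ (G ∩ Y ⁻¹' B) * μ K := by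
    intro G K hG B hB
    rw [Measure.smul_apply, Measure.map_apply hY hB, Measure.restrict_apply (hY hB),
      Set.inter_comm, smul_eq_mul, mul_comm]
  have e0 : (fun ω => τ ω + ((0 : ℝ≥0) : WithTop ℝ≥0)) = τ := by
    funext ω
    exact add_zero _
  set C : Set (Set PathSpace) := (Subtype.val ⁻¹' ·) ''
    (squareCylinders fun _ : ℝ≥0 => {s : Set ℝ | MeasurableSet s})
  have hgen : (inferInstance : MeasurableSpace PathSpace) = MeasurableSpace.generateFrom C := by
    rw [← MeasurableSpace.comap_generateFrom, generateFrom_squareCylinders]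
    rfl
  have hpi : IsPiSystem C :=
    (isPiSystem_squareCylinders (fun _ => MeasurableSpace.isPiSystem_measurableSet)
      (by simp)).comap _
  have hfinm : ∀ G K : Set Ω, IsFiniteMeasure (μ K • (μ.restrict G).map Y) := fun G K =>
    Measure.smul_finite _ (measure_ne_top _ _)
  have key : μ H • (μ.restrict F).map Y = μ F • (μ.restrict H).map Y := by
    refine ext_of_generate_finite C hgen hpi ?_ ?_
    · rintro S hS
      have hSm : MeasurableSet S := by
        have := MeasurableSpace.measurableSet_generateFrom hS
        rwa [← hgen] at this
      rw [hap F H hFm S hSm, hap H F hHm S hSm]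
      obtain ⟨_, ⟨I, A, hA, rfl⟩, rfl⟩ := hS
      have hA' : ∀ i, MeasurableSet (A i) := fun i => hA i trivial
      obtain ⟨h, hh, hI⟩ := hX.exists_measure_inter_eq I hA' 0 fun i _ => zero_le
      have hG : ∀ G : Set Ω, MeasurableSet[hτ.measurableSpace] G →
          (∀ ω ∈ G, stoppedValue X τ ω = x) →
          μ (G ∩ Y ⁻¹' (Subtype.val ⁻¹' ((I : Set ℝ≥0).pi A))) = h x * μ G := by
        intro G hG hGx
        have h1 := hI τ hτ hfin G (by convert hG)
        rw [e0, setLIntegral_congr_fun (hτ.measurableSpace_le _ hG)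
          (fun ω hω => by simp only [hGx ω hω] : Set.EqOn _ (fun _ => h x) G),
          setLIntegral_const] at h1
        rw [← h1]
        refine measure_congr ?_
        filter_upwards [hfin] with ω hω
        refine propext (and_congr_right fun _ => ?_)
        obtain ⟨s, hs⟩ := WithTop.ne_top_iff_exists.1 hω
        change (Y ω).1 ∈ (I : Set ℝ≥0).pi A ↔
          ω ∈ ⋂ i ∈ I, stoppedValue X (fun ω => τ ω + (i : WithTop ℝ≥0)) ⁻¹' A i
        simp only [Set.mem_preimage, Set.mem_pi, Set.mem_iInter, Y, futurePath, stoppedValue,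
          ← hs, ← WithTop.coe_add, Finset.mem_coe]
        rfl
      rw [hG F hF hFx, hG H hH hHx]
      ring
    · rw [hap F H hFm _ .univ, hap H F hHm _ .univ, Set.preimage_univ, Set.inter_univ,
        Set.inter_univ, mul_comm]
  rw [← hap F H hFm B hB, ← hap H F hHm B hB, key]

end StrongMarkov

/-! ### Orientations of the crossings -/

section Orientation

variable {Ω : Type*} {mΩ : MeasurableSpace Ω} {μ : Measure Ω} {𝓕 : Filtration ℝ≥0 mΩ}
  {X : ℝ≥0 → Ω → ℝ} {δ : ℝ} {l : ℤ}

/-- The crossing points of level `0` lie in `δℤ`. -/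
lemma ae_exists_crossingPoint_eq_mul (hδ : 0 < δ) (hc : ∀ ω, Continuous fun t => X t ω)
    (hX0 : ∀ᵐ ω ∂μ, X 0 ω = 0) (hT : ∀ k : ℕ, ∀ᵐ ω ∂μ, crossingTime X δ 0 k ω ≠ ⊤) (k : ℕ) :
    ∀ᵐ ω ∂μ, ∃ m : ℤ, crossingPoint X δ 0 k ω = m * δ := by
  induction k with
  | zero =>
    filter_upwards [hX0] with ω hω
    exact ⟨0, by rw [crossingPoint_eq (u := 0) rfl, hω]; simp⟩
  | succ k ih =>
    filter_upwards [ih, hT (k + 1)] with ω ⟨m, hm⟩ hω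
    have := abs_crossingPoint_succ_sub hδ (hc ω) hω
    rw [zpow_zero, one_mul, hm] at this
    rcases (abs_eq hδ.le).1 this with h | h
    · exact ⟨m + 1, by push_cast; linarith⟩
    · exact ⟨m - 1, by push_cast; linarith⟩

lemma measurable_crossingPoint_past (hδ : 0 < δ) (hX : IsContinuousStrongMarkov μ 𝓕 X) (k : ℕ) :
    Measurable[(isStoppingTime_crossingTime (l := l) hδ hX.continuous_paths hX.adapted
      k).measurableSpace] (crossingPoint X δ l k) :=
  MeasureTheory.measurable_stoppedValue hX.isStronglyProgressive _

lemma measurableSet_orientation_eq (hδ : 0 < δ) (hX : IsContinuousStrongMarkov μ 𝓕 X) (k : ℕ)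
    (a : SignType) : MeasurableSet[(isStoppingTime_crossingTime (l := l) hδ hX.continuous_paths
      hX.adapted (k + 1)).measurableSpace] {ω | orientation X δ l k ω = a} := by
  have h1 := measurable_crossingPoint_past (l := l) hδ hX (k + 1)
  have h0 := (measurable_crossingPoint_past (l := l) hδ hX k).mono
    (IsStoppingTime.measurableSpace_mono _
      (isStoppingTime_crossingTime hδ hX.continuous_paths hX.adapted (k + 1))
      fun ω => crossingTime_le_succ hδ (hX.continuous_paths ω)) le_rfl
  cases a
  · have e : {ω | orientation X δ l k ω = SignType.zero} =
        {ω | crossingPoint X δ l (k + 1) ω = crossingPoint X δ l k ω} := by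
      ext ω
      exact sign_eq_zero_iff.trans sub_eq_zero
    rw [e]
    exact measurableSet_eq_fun h1 h0
  · have e : {ω | orientation X δ l k ω = SignType.neg} =
        {ω | crossingPoint X δ l (k + 1) ω < crossingPoint X δ l k ω} := by
      ext ω
      exact sign_eq_neg_one_iff.trans sub_neg
    rw [e]
    exact measurableSet_lt h1 h0
  · have e : {ω | orientation X δ l k ω = SignType.pos} =
        {ω | crossingPoint X δ l k ω < crossingPoint X δ l (k + 1) ω} := by
      ext ω
      exact sign_eq_one_iff.trans sub_pos
    rw [e]
    exact measurableSet_lt h0 h1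

variable [IsProbabilityMeasure μ] {p : ℝ≥0∞}

/-- Each crossing goes up with probability `p` given the past. On an event of the past on which the
crossing starts at `m * δ`, the conditional probability of going up is the same as on the whole
event that it starts at `m * δ`, where it is `p` by assumption. -/
lemma measure_inter_orientation_one (hδ : 0 < δ) (hX : IsContinuousStrongMarkov μ 𝓕 X)
    (hX0 : ∀ᵐ ω ∂μ, X 0 ω = 0) (hT : ∀ k : ℕ, ∀ᵐ ω ∂μ, crossingTime X δ 0 k ω ≠ ⊤)
    (hp : ∀ (k : ℕ) (m : ℤ), μ {ω | crossingPoint X δ 0 k ω = m * δ} ≠ 0 →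
      upProb μ X δ k (m * δ) = p) (k : ℕ) {F : Set Ω}
    (hF : MeasurableSet[(isStoppingTime_crossingTime (l := 0) hδ hX.continuous_paths hX.adapted
      k).measurableSpace] F) :
    μ (F ∩ {ω | orientation X δ 0 k ω = 1}) = μ F * p := by
  set hτ := isStoppingTime_crossingTime (l := 0) hδ hX.continuous_paths hX.adapted k
  set G : ℤ → Set Ω := fun m => {ω | crossingPoint X δ 0 k ω = m * δ}
  set O : Set Ω := {ω | orientation X δ 0 k ω = 1}
  have hGm : ∀ m, MeasurableSet[hτ.measurableSpace] (G m) := fun m =>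
    measurable_crossingPoint_past hδ hX k (measurableSet_singleton _)
  have hOm : MeasurableSet O :=
    IsStoppingTime.measurableSpace_le _ _ (measurableSet_orientation_eq hδ hX k 1)
  have hFm : MeasurableSet F := hτ.measurableSpace_le _ hF
  have hGm' : ∀ m, MeasurableSet (G m) := fun m => hτ.measurableSpace_le _ (hGm m)
  have hGd : Pairwise (Function.onFun Disjoint G) := by
    intro m n hmn
    refine Set.disjoint_left.2 fun ω (hm : _ = _) (hn : _ = _) => hmn ?_
    exact_mod_cast mul_right_cancel₀ hδ.ne' (hm.symm.trans hn)
  have hone : ∀ m, μ (F ∩ G m ∩ O) = μ (F ∩ G m) * p := by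
    intro m
    by_cases h0 : μ (G m) = 0
    · rw [measure_mono_null (fun ω h => h.1.2) h0, measure_mono_null (fun ω h => h.2) h0, zero_mul]
    let B : Set PathSpace := {y | crossingPoint coord δ 0 1 y = m * δ + δ}
    have hBm : MeasurableSet B :=
      measurable_crossingPoint hδ (fun y => y.2)
        (fun t => (measurable_pi_apply t).comp measurable_subtype_coe) 1
        (measurableSet_singleton _)
    have hae : ∀ H : Set Ω, (H ∩ futurePath hX.continuous_paths (crossingTime X δ 0 k) ⁻¹' B : Set Ω)
        =ᵐ[μ] (H ∩ {ω | crossingPoint X δ 0 (k + 1) ω = m * δ + δ} : Set Ω) := by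
      intro H
      filter_upwards [hT (k + 1)] with ω hω
      refine propext (and_congr_right fun _ => ?_)
      change crossingPoint coord δ 0 1 _ = _ ↔ crossingPoint X δ 0 (k + 1) ω = _
      rw [crossingPoint_coord_one hδ (hX.continuous_paths ω) hω fun t => rfl]
    have haeO : (F ∩ G m ∩ O : Set Ω) =ᵐ[μ]
        (F ∩ G m ∩ {ω | crossingPoint X δ 0 (k + 1) ω = m * δ + δ} : Set Ω) := by
      filter_upwards [hT (k + 1)] with ω hω
      refine propext (and_congr_right fun hG => ?_)
      have hGω : crossingPoint X δ 0 k ω = m * δ := hG.2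
      have := abs_crossingPoint_succ_sub hδ (hX.continuous_paths ω) hω
      rw [zpow_zero, one_mul] at this
      change SignType.sign (_ - _) = 1 ↔ crossingPoint X δ 0 (k + 1) ω = m * δ + δ
      rw [sign_eq_one_iff, ← hGω]
      constructor
      · intro h
        rw [abs_of_pos h] at this
        linarith
      · intro h
        linarith
    have hmul := hX.measure_inter_futurePath_mul hτ (hT k) (hF.inter (hGm m)) (hGm m)
      (x := m * δ) (fun ω h => h.2) (fun ω h => h) hBm
    rw [measure_congr (hae _), measure_congr (hae _),
      ← measure_congr haeO] at hmul
    have hcond : μ (G m ∩ {ω | crossingPoint X δ 0 (k + 1) ω = m * δ + δ}) = μ (G m) * p := by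
      rw [← hp k m h0, upProb, cond_apply (hGm' m), ← mul_assoc,
        ENNReal.mul_inv_cancel h0 (measure_ne_top _ _), one_mul]
    rw [hcond] at hmul
    exact (ENNReal.mul_left_inj h0 (measure_ne_top _ _)).1 (by rw [hmul]; ring)
  have hsplit : ∀ H : Set Ω, MeasurableSet H → μ H = ∑' m, μ (H ∩ G m) := by
    intro H hH
    rw [← measure_iUnion (fun m n hmn => (hGd hmn).mono Set.inter_subset_right
      Set.inter_subset_right) fun m => hH.inter (hGm' m), ← Set.inter_iUnion]
    refine measure_congr ?_
    filter_upwards [ae_exists_crossingPoint_eq_mul hδ hX.continuous_paths hX0 hT k] with ω hω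
    exact propext ⟨fun h => ⟨h, Set.mem_iUnion.2 hω⟩, fun h => h.1⟩
  rw [hsplit _ (hFm.inter hOm), hsplit F hFm, ← ENNReal.tsum_mul_right]
  exact tsum_congr fun m => by rw [← hone m, Set.inter_right_comm]

lemma measure_inter_orientation_neg_one (hδ : 0 < δ) (hX : IsContinuousStrongMarkov μ 𝓕 X)
    (hX0 : ∀ᵐ ω ∂μ, X 0 ω = 0) (hT : ∀ k : ℕ, ∀ᵐ ω ∂μ, crossingTime X δ 0 k ω ≠ ⊤)
    (hp : ∀ (k : ℕ) (m : ℤ), μ {ω | crossingPoint X δ 0 k ω = m * δ} ≠ 0 →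
      upProb μ X δ k (m * δ) = p) (k : ℕ) {F : Set Ω}
    (hF : MeasurableSet[(isStoppingTime_crossingTime (l := 0) hδ hX.continuous_paths hX.adapted
      k).measurableSpace] F) :
    μ (F ∩ {ω | orientation X δ 0 k ω = -1}) = μ F * (1 - p) := by
  have hup := measure_inter_orientation_one hδ hX hX0 hT hp k hF
  have hOm : MeasurableSet {ω | orientation X δ 0 k ω = 1} :=
    IsStoppingTime.measurableSpace_le _ _ (measurableSet_orientation_eq hδ hX k 1)
  have hae : (F ∩ {ω | orientation X δ 0 k ω = -1} : Set Ω) =ᵐ[μ]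
      (F \ {ω | orientation X δ 0 k ω = 1} : Set Ω) := by
    filter_upwards [hT (k + 1)] with ω hω
    refine propext (and_congr_right fun _ => ?_)
    have h := abs_crossingPoint_succ_sub hδ (hX.continuous_paths ω) hω
    have hne : crossingPoint X δ 0 (k + 1) ω - crossingPoint X δ 0 k ω ≠ 0 := by
      rw [← abs_pos, h]
      positivity
    change SignType.sign _ = -1 ↔ ¬ SignType.sign _ = 1
    rw [sign_eq_neg_one_iff, sign_eq_one_iff, not_lt]
    exact ⟨le_of_lt, fun h => lt_of_le_of_ne h hne⟩
  rw [measure_congr hae, ENNReal.mul_sub fun _ _ => measure_ne_top _ _, mul_one, ← hup,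
    ← measure_inter_add_sdiff F hOm, ENNReal.add_sub_cancel_left (measure_ne_top _ _)]

end Orientation

end CrossingTree

open CrossingTree in
theorem mainTheorem5 {Ω : Type*} {mΩ : MeasurableSpace Ω} (μ : Measure Ω) [IsProbabilityMeasure μ]
    (𝓕 : Filtration ℝ≥0 mΩ) (X : ℝ≥0 → Ω → ℝ) (δ : ℝ) (hδ : 0 < δ)
    (hX : CrossingTree.IsContinuousStrongMarkov μ 𝓕 X)
    (hX0 : ∀ᵐ ω ∂μ, X 0 ω = 0)
    (hT : ∀ k : ℕ, ∀ᵐ ω ∂μ, CrossingTree.crossingTime X δ 0 k ω ≠ ⊤)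
    (p : ℝ≥0∞) (hp0 : p ≠ 0) (hp1 : p ≠ 1)
    (hp : ∀ (k : ℕ) (m : ℤ), μ {ω | CrossingTree.crossingPoint X δ 0 k ω = m * δ} ≠ 0 →
      CrossingTree.upProb μ X δ k (m * δ) = p) :
    (∀ᵐ ω ∂μ, {i | CrossingTree.IsExcursion X δ 0 ω i}.Infinite) ∧
    (∀ j : ℕ, AEMeasurable (CrossingTree.excursionType X δ 0 j) μ) ∧
    iIndepFun (fun j : ℕ => CrossingTree.excursionType X δ 0 j) μ ∧
    ∀ j : ℕ, μ {ω | CrossingTree.excursionType X δ 0 j ω = 0} = 1 / 2 ∧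
      μ {ω | CrossingTree.excursionType X δ 0 j ω = 1} = 1 / 2 := by
  have hst := isStoppingTime_crossingTime (l := 0) hδ hX.continuous_paths hX.adapted
  have hmono : Monotone fun k => (hst k).measurableSpace := monotone_nat_of_le_succ fun k =>
    IsStoppingTime.measurableSpace_mono _ _
      fun ω => crossingTime_le_succ hδ (hX.continuous_paths ω)
  have hp_le : p ≤ 1 := by
    have h := measure_inter_orientation_one hδ hX hX0 hT hp 0 (F := Set.univ) .univ
    rw [measure_univ, one_mul] at h
    exact h ▸ prob_le_one
  -- The past of the pair `(2i, 2i+1)` of crossings.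
  let G : Filtration ℕ mΩ :=
    { seq := fun i => (hst (2 * i)).measurableSpace
      mono' := fun i j hij => hmono (by omega)
      le' := fun i => (hst (2 * i)).measurableSpace_le }
  set U : ℕ → Set Ω := fun i => {ω | IsUpExcursion X δ 0 ω i}
  set D : ℕ → Set Ω := fun i => {ω | IsDownExcursion X δ 0 ω i}
  have hpair : ∀ a b : SignType, ∀ i, MeasurableSet[G (i + 1)]
      ({ω | orientation X δ 0 (2 * i) ω = a} ∩ {ω | orientation X δ 0 (2 * i + 1) ω = b}) :=
    fun a b i => ((hmono (by omega : 2 * i + 1 ≤ 2 * (i + 1))) _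
      (measurableSet_orientation_eq hδ hX (2 * i) a)).inter
      (measurableSet_orientation_eq hδ hX (2 * i + 1) b)
  have hU : ∀ i, MeasurableSet[G (i + 1)] (U i) := hpair 1 (-1)
  have hD : ∀ i, MeasurableSet[G (i + 1)] (D i) := hpair (-1) 1
  have hdisj : ∀ i, Disjoint (U i) (D i) := fun i =>
    Set.disjoint_left.2 fun ω h1 h2 => absurd (h1.1.symm.trans h2.1) (by decide)
  have hr : p * (1 - p) ≠ 0 :=
    mul_ne_zero hp0 (tsub_pos_of_lt (lt_of_le_of_ne hp_le hp1)).ne'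
  have hFpast : ∀ (a : SignType) i F, MeasurableSet[G i] F →
      MeasurableSet[(hst (2 * i + 1)).measurableSpace]
        (F ∩ {ω | orientation X δ 0 (2 * i) ω = a}) := fun a i F hF =>
    (hmono (Nat.le_succ _) _ hF).inter (measurableSet_orientation_eq hδ hX (2 * i) a)
  have hUr : ∀ i F, MeasurableSet[G i] F → μ (F ∩ U i) = μ F * (p * (1 - p)) := fun i F hF => by
    have h := measure_inter_orientation_neg_one hδ hX hX0 hT hp (2 * i + 1) (hFpast 1 i F hF)
    rw [measure_inter_orientation_one hδ hX hX0 hT hp (2 * i) hF, Set.inter_assoc] at h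
    exact h.trans (mul_assoc _ _ _)
  have hDr : ∀ i F, MeasurableSet[G i] F → μ (F ∩ D i) = μ F * (p * (1 - p)) := fun i F hF => by
    have h := measure_inter_orientation_one hδ hX hX0 hT hp (2 * i + 1) (hFpast (-1) i F hF)
    rw [measure_inter_orientation_neg_one hδ hX hX0 hT hp (2 * i) hF, Set.inter_assoc] at h
    exact h.trans (by ring)
  have hinf : ∀ᵐ ω ∂μ, {i | ω ∈ U i ∪ D i}.Infinite :=
    ae_infinite_marks hU hD hdisj hr hUr hDr
  have hV : ∀ j, excursionType X δ 0 j =ᵐ[μ] (downAt U D j).indicator 1 := by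
    intro j
    filter_upwards [hinf] with ω hω
    have hmem : ω ∈ U _ ∪ D _ := Nat.nth_mem_of_infinite hω j
    have hiff := mem_downAt_iff hω j
    by_cases h : ω ∈ U (Nat.nth (fun i => ω ∈ U i ∪ D i) j)
    · have hnot : ω ∉ downAt U D j := fun h' => Set.disjoint_left.1 (hdisj _) h (hiff.1 h')
      rw [Set.indicator_of_notMem hnot]
      exact if_pos h
    · rw [Set.indicator_of_mem (hiff.2 (hmem.resolve_left h))]
      exact if_neg h
  have hdm := measurableSet_downAt hU hD
  have hhalf := measure_downAt hU hD hdisj hr hUr hDr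
  refine ⟨hinf, fun j => ⟨_, measurable_one.indicator (hdm j), hV j⟩, ?_, fun j => ⟨?_, ?_⟩⟩
  · exact (iIndepFun_congr hV).2
      (iIndepSet_downAt hU hD hdisj hr hUr hDr).iIndepFun_indicator
  · have e : {ω | excursionType X δ 0 j ω = 0} =ᵐ[μ] ((downAt U D j)ᶜ : Set Ω) := by
      filter_upwards [hV j] with ω hω
      refine propext ?_
      change excursionType X δ 0 j ω = 0 ↔ ω ∉ downAt U D j
      rw [hω]
      by_cases h : ω ∈ downAt U D j <;> simp [h]
    rw [measure_congr e, prob_compl_eq_one_sub (hdm j), hhalf, one_div, ENNReal.one_sub_inv_two]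
  · have e : {ω | excursionType X δ 0 j ω = 1} =ᵐ[μ] downAt U D j := by
      filter_upwards [hV j] with ω hω
      refine propext ?_
      change excursionType X δ 0 j ω = 1 ↔ ω ∈ downAt U D j
      rw [hω]
      by_cases h : ω ∈ downAt U D j <;> simp [h]
    rw [measure_congr e, hhalf, one_div]
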